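/- Setting. Let $f:\mathbb R^n\to(-\infty,+\infty]$ and $g:\mathbb R^m\to(-\infty,+\infty]$ be proper closed convex functions, $g^*$ the convex conjugate of $g$, and $K\in\mathbb R^{m\times n}$. Consider $$\min_{x\in\mathbb R^n}\max_{y\in\mathbb R^m}\ \mathcal L(x,y):=f(x)+\langle Kx,y\rangle-g^*(y), \tag{PD}$$ and assume that (PD) has a saddle point $(x^\star,y^\star)\in\operatorname{dom}f\times\operatorname{dom}g^*$, i.e. $\mathcal L(x^\star,y)\le\mathcal L(x^\star,y^\star)\le\mathcal L(x,y^\star)$ for all $x,y$. Let $\Sigma_f$ be a symmetric positive semidefinite matrix with $\langle\xi_1-\xi_2,x_1-x_2\rangle\ge\|x_1-x_2\|_{\Sigma_f}^2$ for all $x_1,x_2$ and $\xi_i\in\partial f(x_i)$, where $\|z\|_M^2:=\langle z,Mz\rangle$. Let $M_1\in\mathbb R^{n\times n}$, $M_2\in\mathbb R^{m\times m}$ be symmetric and, for $\rho_1>0$, consider the condition $$M_1+\tfrac12\Sigma_f\succ0,\qquad M_2\succ0,\qquad \Big\|M_2^{-1/2}K\big(M_1+\tfrac12\Sigma_f\big)^{-1/2}\Big\|^2\le\rho_1,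 \tag{C}$$ with $\|\cdot\|$ the spectral norm. The preconditioned primal-dual hybrid gradient method (PrePDHG), started at an arbitrary $(x^0,y^0)$ and run without stopping, generates $\{(x^k,y^k)\}_{k\ge0}$ by $$x^{k+1}=\operatorname*{argmin}_{x}\ f(x)+\langle Kx,y^k\rangle+\tfrac12\|x-x^k\|_{M_1}^2,\qquad y^{k+1}=\operatorname*{argmin}_{y}\ g^*(y)-\langle K(2x^{k+1}-x^k),y\rangle+\tfrac12\|y-y^k\|_{M_2}^2 .$$ Lemma 3.3. (a) If $\rho_1\in(0,4/3)$, then under (C) every sequence $\{(x^k,y^k)\}$ generated by PrePDHG converges to a saddle point of (PD). (b) If $\rho_1\ge4/3$, then under (C) the sequence need not converge: for every $\rho_1\ge 4/3$ there are a problem (PD) as above, matrices $\Sigma_f,M_1,M_2$ satisfying (C), and a sequence generated by PrePDHG that does not converge. Explicitly, let $\tau,\sigma>0$ with $\tau\sigma=4/3$ and consider $\min_{x\in\mathbb R}\max_{y\in\mathbb R}xy$ (that is, $n=m=1$, $K=1$, $f=0$, $g$ the indicator function of $\{0\}$, so $g^*=0$) with $\Sigma_f=0$, $M_1=1/\tau$,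 $M_2=1/\sigma$. Then all the assumptions above, including (C) for every $\rho_1\ge4/3$, hold; the unique saddle point is $(0,0)$; the method can be run from every initial point, and its sequences are exactly those with $$\begin{pmatrix}x^{k+1}\\y^{k+1}\end{pmatrix}=G\begin{pmatrix}x^{k}\\y^{k}\end{pmatrix},\qquad G=\begin{pmatrix}1&-\tau\\ \sigma&1-2\tau\sigma\end{pmatrix};$$ the eigenvalues of $G$ are $-1$ and $1/3$; and $\{(x^k,y^k)\}$ converges if and only if $(x^0,y^0)$ lies on the line $\{a\,(2,\sigma):a\in\mathbb R\}$. In particular, it diverges for every initial point outside this line. -/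

import Mathlib

open Filter Topology
open scoped Matrix MatrixOrder Matrix.Norms.L2Operator

noncomputable section

namespace PrePDHG

/-- The space `ℝⁿ` with the standard inner product. -/
abbrev Vec (n : ℕ) := EuclideanSpace ℝ (Fin n)

/-- The product `A x` of a matrix and a vector of a Euclidean space. -/
def mulV {m n : ℕ} (A : Matrix (Fin m) (Fin n) ℝ) (x : Vec n) : Vec m :=
  Matrix.toEuclideanLin A x

/-- The quadratic form `‖x‖²_M = ⟨x, M x⟩` (not necessarily nonnegative). -/
def sqForm {n : ℕ} (M : Matrix (Fin n) (Fin n) ℝ) (x : Vec n) : ℝ :=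
  inner ℝ x (mulV M x)

/-- `f : ℝⁿ → (-∞, +∞]` is proper, closed (lower semicontinuous) and convex
(its epigraph is a convex set). -/
def ProperClosedConvex {n : ℕ} (f : Vec n → EReal) : Prop :=
  (∀ x, f x ≠ ⊥) ∧ (∃ x, f x ≠ ⊤) ∧ LowerSemicontinuous f ∧
    Convex ℝ {p : Vec n × ℝ | f p.1 ≤ (p.2 : EReal)}

/-- The convex conjugate `g*(y) = sup_z (⟨z, y⟩ - g z)`. -/
def conj {m : ℕ} (g : Vec m → EReal) (y : Vec m) : EReal :=
  ⨆ z : Vec m, ((inner ℝ z y : ℝ) : EReal) - g z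

/-- The subdifferential of `f` at `x`; it is empty when `x` is not in the domain of `f`. -/
def subdiff {n : ℕ} (f : Vec n → EReal) (x : Vec n) : Set (Vec n) :=
  {ξ | f x ≠ ⊤ ∧ ∀ z, f x + ((inner ℝ ξ (z - x) : ℝ) : EReal) ≤ f z}

/-- `S` is a symmetric positive semidefinite matrix `Σ_f` such that
`⟨ξ₁ - ξ₂, x₁ - x₂⟩ ≥ ‖x₁ - x₂‖²_S` for all `ξ₁ ∈ ∂f(x₁)`, `ξ₂ ∈ ∂f(x₂)`. -/
def MonotoneModulus {n : ℕ} (f : Vec n → EReal) (S : Matrix (Fin n) (Fin n) ℝ) : Prop :=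
  S.PosSemidef ∧ ∀ x₁ x₂, ∀ ξ₁ ∈ subdiff f x₁, ∀ ξ₂ ∈ subdiff f x₂,
    sqForm S (x₁ - x₂) ≤ inner ℝ (ξ₁ - ξ₂) (x₁ - x₂)

/-- The saddle function `L(x, y) = f(x) + ⟨K x, y⟩ - g*(y)`. -/
def lagrangian {n m : ℕ} (f : Vec n → EReal) (g : Vec m → EReal)
    (K : Matrix (Fin m) (Fin n) ℝ) (x : Vec n) (y : Vec m) : EReal :=
  f x + ((inner ℝ (mulV K x) y : ℝ) : EReal) - conj g y

/-- `(x, y)` is a saddle point of `L`, with `x ∈ dom f` and `y ∈ dom g*`, so that no difference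
`∞ - ∞` occurs in the two inequalities. -/
def IsSaddle {n m : ℕ} (f : Vec n → EReal) (g : Vec m → EReal)
    (K : Matrix (Fin m) (Fin n) ℝ) (x : Vec n) (y : Vec m) : Prop :=
  f x ≠ ⊤ ∧ conj g y ≠ ⊤ ∧
    (∀ y', lagrangian f g K x y' ≤ lagrangian f g K x y) ∧
    (∀ x', lagrangian f g K x y ≤ lagrangian f g K x' y)

/-- `M₁ + S/2 ≻ 0`, `M₂ ≻ 0` and `‖M₂^{-1/2} K (M₁ + S/2)^{-1/2}‖² ≤ ρ`, where `‖·‖` is the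
spectral norm and `A^{-1/2}` is the positive semidefinite square root of `A⁻¹`. -/
def StepCondition {n m : ℕ} (K : Matrix (Fin m) (Fin n) ℝ) (S M₁ : Matrix (Fin n) (Fin n) ℝ)
    (M₂ : Matrix (Fin m) (Fin m) ℝ) (ρ : ℝ) : Prop :=
  (M₁ + (1 / 2 : ℝ) • S).PosDef ∧ M₂.PosDef ∧
    ‖CFC.sqrt M₂⁻¹ * K * CFC.sqrt (M₁ + (1 / 2 : ℝ) • S)⁻¹‖ ^ 2 ≤ ρ

/-- The standing assumptions on the problem `min_x max_y f(x) + ⟨K x, y⟩ - g*(y)` together with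
the condition on the proximal matrices with the bound `ρ`. Symmetry of `M₁` and `M₂` is contained
in positive definiteness (and in the symmetry of `S`). -/
def Admissible {n m : ℕ} (f : Vec n → EReal) (g : Vec m → EReal)
    (K : Matrix (Fin m) (Fin n) ℝ) (S M₁ : Matrix (Fin n) (Fin n) ℝ)
    (M₂ : Matrix (Fin m) (Fin m) ℝ) (ρ : ℝ) : Prop :=
  ProperClosedConvex f ∧ ProperClosedConvex g ∧ MonotoneModulus f S ∧
    (∃ x y, IsSaddle f g K x y) ∧ StepCondition K S M₁ M₂ ρ

/-- `(xᵏ, yᵏ)` is generated by the preconditioned primal-dual hybrid gradient iteration: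
`xᵏ⁺¹` minimizes `f(x) + ⟨K x, yᵏ⟩ + ½ ‖x - xᵏ‖²_{M₁}` and
`yᵏ⁺¹` minimizes `g*(y) - ⟨K (2 xᵏ⁺¹ - xᵏ), y⟩ + ½ ‖y - yᵏ‖²_{M₂}`. -/
def IsRun {n m : ℕ} (f : Vec n → EReal) (g : Vec m → EReal)
    (K : Matrix (Fin m) (Fin n) ℝ) (M₁ : Matrix (Fin n) (Fin n) ℝ)
    (M₂ : Matrix (Fin m) (Fin m) ℝ) (x : ℕ → Vec n) (y : ℕ → Vec m) : Prop :=
  ∀ k,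
    IsMinOn (fun u : Vec n =>
      f u + ((inner ℝ (mulV K u) (y k) + 1 / 2 * sqForm M₁ (u - x k) : ℝ) : EReal))
      Set.univ (x (k + 1)) ∧
    IsMinOn (fun v : Vec m =>
      conj g v + ((-inner ℝ (mulV K ((2 : ℝ) • x (k + 1) - x k)) v
        + 1 / 2 * sqForm M₂ (v - y k) : ℝ) : EReal))
      Set.univ (y (k + 1))

/-- The sequence of pairs `(xᵏ, yᵏ)` has a limit. -/
def Converges {n m : ℕ} (x : ℕ → Vec n) (y : ℕ → Vec m) : Prop :=
  ∃ p : Vec n × Vec m, Tendsto (fun k => (x k, y k)) atTop (𝓝 p)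

/-- The function `f = 0` on `ℝ`, first half of the bilinear problem `min_x max_y x y`. -/
def bilinF : Vec 1 → EReal := fun _ => 0

open Classical in
/-- The indicator function of `{0}` in `ℝ`, whose conjugate is `g* = 0`. -/
def bilinG : Vec 1 → EReal := fun z => if z = 0 then 0 else ⊤

/-- The iteration matrix of the method on `min_x max_y x y` with `M₁ = 1/τ`, `M₂ = 1/σ`. -/
def iterMatrix (τ σ : ℝ) : Matrix (Fin 2) (Fin 2) ℝ :=
  !![1, -τ; σ, 1 - 2 * τ * σ]

end PrePDHG

end

namespace PrePDHG

/-! ### Quadratic forms -/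

/-! Convergence rests on a Lyapunov function. Put `A = M₁ + S/2`, `L = M₂⁻¹ K`, `p k = x (k+1) - x
k` and `l k = y k + L (p k)`. In terms of `l` the dual step has no extrapolation, and monotonicity
at a saddle point (`dist_descent`) shows that the squared distance `V k`, in the norms of `M₁ + S`
and `M₂`, drops by `‖p‖²_A + ‖d‖²_{M₂} - 2⟨d, K p⟩`, where `p = p (k+1)` and `d = l (k+1) - l k`. If
`‖L v‖²_{M₂} ≤ ‖v‖²_A`, this is nonnegative by Young's inequality; a larger bound `1 + ε` needs more
information on the cross term.

That information is monotonicity of `∂f` at two consecutive iterates (`cross_term_le`): up to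
`2ε‖p‖²_A`, the cross term is at most the decrement of a nonnegative quadratic `φ`. Adding `2θ`
times this estimate and applying Young's inequality to the remaining share `1 - θ` of the cross term
leaves a decrease `c‖p‖²_A`; the best `θ` gives `c = (1 - 3ε)/(1 + ε)`, positive exactly when `1 + ε
< 4/3`. Then successive differences vanish, cluster points are saddle points because
subdifferentials have closed graphs, and the existence of `lim V` about a cluster point forces the
whole sequence to converge.

The threshold is sharp: for the bilinear problem with `τσ = 4/3` the iteration is linear with an
eigenvalue `-1`. -/

theorem mulV_add {m n : ℕ} (A : Matrix (Fin m) (Fin n) ℝ) (x y : Vec n) :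
    mulV A (x + y) = mulV A x + mulV A y := map_add _ _ _

theorem mulV_sub {m n : ℕ} (A : Matrix (Fin m) (Fin n) ℝ) (x y : Vec n) :
    mulV A (x - y) = mulV A x - mulV A y := map_sub _ _ _

theorem mulV_smul {m n : ℕ} (A : Matrix (Fin m) (Fin n) ℝ) (t : ℝ) (x : Vec n) :
    mulV A (t • x) = t • mulV A x := map_smul _ _ _

theorem mulV_mul {m n l : ℕ} (A : Matrix (Fin m) (Fin n) ℝ) (B : Matrix (Fin n) (Fin l) ℝ)
    (x : Vec l) : mulV (A * B) x = mulV A (mulV B x) := by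
  simp [mulV]

theorem mulV_one {n : ℕ} (x : Vec n) : mulV (1 : Matrix (Fin n) (Fin n) ℝ) x = x := by
  simp [mulV]

theorem add_mulV {m n : ℕ} (A B : Matrix (Fin m) (Fin n) ℝ) (x : Vec n) :
    mulV (A + B) x = mulV A x + mulV B x := by
  simp [mulV]

theorem smul_mulV {m n : ℕ} (t : ℝ) (A : Matrix (Fin m) (Fin n) ℝ) (x : Vec n) :
    mulV (t • A) x = t • mulV A x := by
  simp [mulV]

theorem continuous_mulV {m n : ℕ} (A : Matrix (Fin m) (Fin n) ℝ) : Continuous (mulV A) :=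
  LinearMap.continuous_of_finiteDimensional _

theorem continuous_sqForm {n : ℕ} (A : Matrix (Fin n) (Fin n) ℝ) : Continuous (sqForm A) :=
  continuous_id.inner (continuous_mulV A)

theorem sqForm_zero {n : ℕ} (A : Matrix (Fin n) (Fin n) ℝ) : sqForm A 0 = 0 := by
  simp [sqForm]

theorem sqForm_add_matrix {n : ℕ} (A B : Matrix (Fin n) (Fin n) ℝ) (x : Vec n) :
    sqForm (A + B) x = sqForm A x + sqForm B x := by
  simp [sqForm, add_mulV, inner_add_right]

theorem sqForm_smul_matrix {n : ℕ} (t : ℝ) (A : Matrix (Fin n) (Fin n) ℝ) (x : Vec n) :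
    sqForm (t • A) x = t * sqForm A x := by
  simp [sqForm, smul_mulV, inner_smul_right]

theorem inner_mulV_left {m n : ℕ} (A : Matrix (Fin m) (Fin n) ℝ) (x : Vec n) (y : Vec m) :
    inner ℝ (mulV A x) y = inner ℝ x (mulV Aᵀ y) := by
  have h : Matrix.toEuclideanLin Aᵀ = (Matrix.toEuclideanLin A).adjoint := by
    rw [← Matrix.toEuclideanLin_conjTranspose_eq_adjoint, Matrix.conjTranspose_eq_transpose_of_trivial]
  rw [mulV, mulV, h, LinearMap.adjoint_inner_right]

theorem inner_mulV_comm {n : ℕ} {A : Matrix (Fin n) (Fin n) ℝ} (hA : A.IsHermitian)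
    (x y : Vec n) : inner ℝ (mulV A x) y = inner ℝ (mulV A y) x := by
  have h : Aᵀ = A := by simpa using hA.eq
  rw [inner_mulV_left, h, real_inner_comm]

theorem sqForm_sub {n : ℕ} {A : Matrix (Fin n) (Fin n) ℝ} (hA : A.IsHermitian) (x y : Vec n) :
    sqForm A (x - y) = sqForm A x - 2 * inner ℝ (mulV A x) y + sqForm A y := by
  have h := inner_mulV_comm hA x y
  simp only [sqForm, mulV_sub, inner_sub_left, inner_sub_right]
  rw [real_inner_comm (mulV A y) x] at *
  rw [real_inner_comm (mulV A x) y]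
  linarith

theorem sqForm_add {n : ℕ} {A : Matrix (Fin n) (Fin n) ℝ} (hA : A.IsHermitian) (x y : Vec n) :
    sqForm A (x + y) = sqForm A x + 2 * inner ℝ (mulV A x) y + sqForm A y := by
  have h := inner_mulV_comm hA x y
  simp only [sqForm, mulV_add, inner_add_left, inner_add_right]
  rw [real_inner_comm (mulV A y) x] at *
  rw [real_inner_comm (mulV A x) y]
  linarith

theorem sqForm_smul {n : ℕ} (A : Matrix (Fin n) (Fin n) ℝ) (t : ℝ) (x : Vec n) :
    sqForm A (t • x) = t ^ 2 * sqForm A x := by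
  simp only [sqForm, mulV_smul, inner_smul_left, inner_smul_right]
  simp; ring

/-- Three-point identity. It is purely algebraic, hence applicable to `M₁`, which may be indefinite.
-/
theorem two_inner_mulV_sub {n : ℕ} {A : Matrix (Fin n) (Fin n) ℝ} (hA : A.IsHermitian)
    (x y : Vec n) :
    2 * inner ℝ (mulV A (x - y)) x = sqForm A x - sqForm A y + sqForm A (x - y) := by
  have h := inner_mulV_comm hA x y
  rw [sqForm_sub hA, mulV_sub, inner_sub_left]
  simp only [sqForm]
  rw [real_inner_comm (mulV A x) x]
  linarith

theorem sqForm_nonneg {n : ℕ} {A : Matrix (Fin n) (Fin n) ℝ} (hA : A.PosSemidef) (x : Vec n) :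
    0 ≤ sqForm A x := by
  have := hA.dotProduct_mulVec_nonneg x.ofLp
  simpa [sqForm, mulV, Matrix.toLpLin_apply, EuclideanSpace.inner_eq_star_dotProduct,
    dotProduct_comm] using this

/-- This is `‖x + y‖²_A ≥ 0`. It converts strong monotonicity measured at two points into control of
the step between them, which is why `S` enters the step condition with the factor `1/2`. -/
theorem sqForm_sub_le {n : ℕ} {A : Matrix (Fin n) (Fin n) ℝ} (hA : A.PosSemidef) (x y : Vec n) :
    sqForm A (x - y) ≤ 2 * sqForm A x + 2 * sqForm A y := by
  have h := sqForm_nonneg hA (x + y)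
  rw [sqForm_add hA.isHermitian] at h
  rw [sqForm_sub hA.isHermitian]
  linarith

/-- The inverse square root `A^{-1/2}` maps some `q` with `‖q‖² = ‖p‖²_A` to `p`. -/
theorem exists_sqrt_inv_preimage {n : ℕ} {A : Matrix (Fin n) (Fin n) ℝ} (hA : A.PosDef)
    (p : Vec n) : ∃ q : Vec n, mulV (CFC.sqrt A⁻¹) q = p ∧ ‖q‖ ^ 2 = sqForm A p := by
  have hmul : CFC.sqrt A⁻¹ * CFC.sqrt A⁻¹ = A⁻¹ :=
    CFC.sqrt_mul_sqrt_self _ hA.inv.posSemidef.nonneg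
  have hherm : (CFC.sqrt A⁻¹).IsHermitian :=
    (Matrix.nonneg_iff_posSemidef.mp (CFC.sqrt_nonneg A⁻¹)).isHermitian
  have hinv : A⁻¹ * A = 1 := Matrix.nonsing_inv_mul _ hA.det_pos.ne'.isUnit
  have hp : mulV (CFC.sqrt A⁻¹) (mulV (CFC.sqrt A⁻¹) (mulV A p)) = p := by
    rw [← mulV_mul, hmul, ← mulV_mul, hinv, mulV_one]
  refine ⟨mulV (CFC.sqrt A⁻¹) (mulV A p), hp, ?_⟩
  rw [← real_inner_self_eq_norm_sq, inner_mulV_comm hherm, hp, sqForm]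

theorem norm_mulV_le {m n : ℕ} (A : Matrix (Fin m) (Fin n) ℝ) (x : Vec n) :
    ‖mulV A x‖ ≤ ‖A‖ * ‖x‖ := by
  simpa [mulV, Matrix.toLpLin_apply] using Matrix.l2_opNorm_mulVec A x

theorem exists_norm_sq_le_sqForm {n : ℕ} {A : Matrix (Fin n) (Fin n) ℝ} (hA : A.PosDef) :
    ∃ C : ℝ, ∀ p, ‖p‖ ^ 2 ≤ C * sqForm A p := by
  refine ⟨‖CFC.sqrt A⁻¹‖ ^ 2, fun p => ?_⟩
  obtain ⟨q, rfl, hq⟩ := exists_sqrt_inv_preimage hA p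
  rw [← hq, ← mul_pow]
  exact pow_le_pow_left₀ (norm_nonneg _) (norm_mulV_le _ _) 2

/-- The left side is `‖M₂^{-1/2} K p‖²`; writing `p` as the image of `q` under the inverse square
root exposes the matrix whose spectral norm is bounded. The convergence proof uses the norm bound
only in this form. -/
theorem StepCondition.sqForm_le {n m : ℕ} {K : Matrix (Fin m) (Fin n) ℝ}
    {S M₁ : Matrix (Fin n) (Fin n) ℝ} {M₂ : Matrix (Fin m) (Fin m) ℝ} {ρ : ℝ}
    (h : StepCondition K S M₁ M₂ ρ) (p : Vec n) :
    sqForm M₂ (mulV (M₂⁻¹ * K) p) ≤ ρ * sqForm (M₁ + (1 / 2 : ℝ) • S) p := by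
  obtain ⟨hA, hB, hn⟩ := h
  obtain ⟨q, hq, hq2⟩ := exists_sqrt_inv_preimage hA p
  have hinv : M₂ * M₂⁻¹ = 1 := Matrix.mul_nonsing_inv _ hB.det_pos.ne'.isUnit
  have hmul : CFC.sqrt M₂⁻¹ * CFC.sqrt M₂⁻¹ = M₂⁻¹ :=
    CFC.sqrt_mul_sqrt_self _ hB.inv.posSemidef.nonneg
  have hherm : (CFC.sqrt M₂⁻¹).IsHermitian :=
    (Matrix.nonneg_iff_posSemidef.mp (CFC.sqrt_nonneg M₂⁻¹)).isHermitian
  have h1 : sqForm M₂ (mulV (M₂⁻¹ * K) p) = ‖mulV (CFC.sqrt M₂⁻¹) (mulV K p)‖ ^ 2 := by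
    rw [← real_inner_self_eq_norm_sq, inner_mulV_comm hherm, ← mulV_mul, hmul, sqForm,
      ← mulV_mul, ← Matrix.mul_assoc, hinv, Matrix.one_mul, mulV_mul]
  have h2 : mulV (CFC.sqrt M₂⁻¹) (mulV K p) =
      mulV (CFC.sqrt M₂⁻¹ * K * CFC.sqrt (M₁ + (1 / 2 : ℝ) • S)⁻¹) q := by
    rw [mulV_mul, mulV_mul, hq]
  rw [h1, h2, ← hq2]
  calc _ ≤ (‖CFC.sqrt M₂⁻¹ * K * CFC.sqrt (M₁ + (1 / 2 : ℝ) • S)⁻¹‖ * ‖q‖) ^ 2 :=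
        pow_le_pow_left₀ (norm_nonneg _) (norm_mulV_le _ _) 2
    _ ≤ ρ * ‖q‖ ^ 2 := by
        rw [mul_pow]
        exact mul_le_mul_of_nonneg_right hn (sq_nonneg _)

/-! ### Convex conjugates and subdifferentials -/

theorem conj_le_iff {m : ℕ} {g : Vec m → EReal} {y : Vec m} {r : EReal} :
    conj g y ≤ r ↔ ∀ z, ((inner ℝ z y : ℝ) : EReal) - g z ≤ r := iSup_le_iff

/-- A conjugate is a supremum of affine functions; points with `g z = ⊤` contribute only the
constant `⊥`. A point where the conjugate is finite comes from the saddle point, so no affine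
minorant of `g` has to be constructed. -/
theorem ProperClosedConvex.conj {m : ℕ} {g : Vec m → EReal} (hg : ProperClosedConvex g)
    (hd : ∃ y, conj g y ≠ ⊤) : ProperClosedConvex (conj g) := by
  obtain ⟨hbot, ⟨z₀, hz₀⟩, -, -⟩ := hg
  refine ⟨fun y h => ?_, hd, ?_, ?_⟩
  · have h1 := conj_le_iff.mp h.le z₀
    lift g z₀ to ℝ using ⟨hz₀, hbot z₀⟩ with r
    rw [← EReal.coe_sub, le_bot_iff] at h1
    exact EReal.coe_ne_bot _ h1
  · refine lowerSemicontinuous_iSup fun z => Continuous.lowerSemicontinuous ?_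
    rcases eq_or_ne (g z) ⊤ with h | h
    · simpa [h] using continuous_const
    · lift g z to ℝ using ⟨h, hbot z⟩ with r
      simp only [← EReal.coe_sub]
      exact continuous_coe_real_ereal.comp ((continuous_const.inner continuous_id).sub
        continuous_const)
  · rintro ⟨y₁, r₁⟩ h₁ ⟨y₂, r₂⟩ h₂ a b ha hb hab
    simp only [Set.mem_ofPred_eq, conj_le_iff] at h₁ h₂ ⊢
    intro z
    specialize h₁ z
    specialize h₂ z
    rcases eq_or_ne (g z) ⊤ with h | h
    · simp [h]
    · lift g z to ℝ using ⟨h, hbot z⟩ with r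
      simp only [← EReal.coe_sub, EReal.coe_le_coe_iff] at *
      simp only [Prod.smul_mk, Prod.mk_add_mk, inner_add_right, inner_smul_right, smul_eq_mul]
      have : b = 1 - a := by linarith
      subst this
      nlinarith [mul_le_mul_of_nonneg_left h₁ ha, mul_le_mul_of_nonneg_left h₂ hb]

theorem subdiff_real {n : ℕ} {f : Vec n → EReal} {x z ξ : Vec n} {r s : ℝ}
    (h : ξ ∈ subdiff f x) (hx : f x = r) (hz : f z = s) : r + inner ℝ ξ (z - x) ≤ s := by
  have := h.2 z
  rw [hx, hz] at this
  exact_mod_cast this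

theorem mem_subdiff_of_real {n : ℕ} {f : Vec n → EReal} {x ξ : Vec n} {r : ℝ}
    (hbot : ∀ x, f x ≠ ⊥) (hx : f x = r)
    (h : ∀ z (s : ℝ), f z = s → r + inner ℝ ξ (z - x) ≤ s) : ξ ∈ subdiff f x := by
  refine ⟨by simp [hx], fun z => ?_⟩
  rcases eq_or_ne (f z) ⊤ with hz | hz
  · simp [hz]
  · have := h z (f z).toReal (EReal.coe_toReal hz (hbot z)).symm
    rw [hx, ← EReal.coe_toReal hz (hbot z)]
    exact_mod_cast this

theorem subdiff_monotone {n : ℕ} {f : Vec n → EReal} (hbot : ∀ x, f x ≠ ⊥) {x₁ x₂ ξ₁ ξ₂ : Vec n}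
    (h₁ : ξ₁ ∈ subdiff f x₁) (h₂ : ξ₂ ∈ subdiff f x₂) : 0 ≤ inner ℝ (ξ₁ - ξ₂) (x₁ - x₂) := by
  have e₁ := (EReal.coe_toReal h₁.1 (hbot x₁)).symm
  have e₂ := (EReal.coe_toReal h₂.1 (hbot x₂)).symm
  have a₁ := subdiff_real h₁ e₁ e₂
  have a₂ := subdiff_real h₂ e₂ e₁
  simp only [inner_sub_left, inner_sub_right] at *
  linarith

/-- The graph of the subdifferential is closed. -/
theorem subdiff_closed {n : ℕ} {f : Vec n → EReal} (hf : ProperClosedConvex f)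
    {u ξ : ℕ → Vec n} {u₀ ξ₀ : Vec n} (hu : Tendsto u atTop (𝓝 u₀)) (hξ : Tendsto ξ atTop (𝓝 ξ₀))
    (h : ∀ k, ξ k ∈ subdiff f (u k)) : ξ₀ ∈ subdiff f u₀ := by
  obtain ⟨hbot, ⟨z₀, hz₀⟩, hlsc, -⟩ := hf
  -- If this failed, a real `c` would lie strictly between the two sides: semicontinuity puts `f (u
  -- k)` above `c` eventually, while the subgradient inequality at `u k` puts it below.
  have key : ∀ z (s : ℝ), f z = s → f u₀ ≤ ((s - inner ℝ ξ₀ (z - u₀) : ℝ) : EReal) := by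
    intro z s hz
    by_contra! hlt
    obtain ⟨c, hc1, hc2⟩ := EReal.lt_iff_exists_real_btwn.mp hlt
    have ev1 := hu.eventually (hlsc u₀ c hc2)
    have lim : Tendsto (fun k => s - inner ℝ (ξ k) (z - u k)) atTop
        (𝓝 (s - inner ℝ ξ₀ (z - u₀))) :=
      tendsto_const_nhds.sub (hξ.inner (tendsto_const_nhds.sub hu))
    have ev2 := lim.eventually_lt_const (EReal.coe_lt_coe_iff.mp hc1)
    obtain ⟨k, hk1, hk2⟩ := (ev1.and ev2).exists
    have e := (EReal.coe_toReal (h k).1 (hbot (u k))).symm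
    have := subdiff_real (h k) e hz
    rw [e, gt_iff_lt, EReal.coe_lt_coe_iff] at hk1
    linarith
  have htop : f u₀ ≠ ⊤ := fun ht => by
    have := key z₀ _ (EReal.coe_toReal hz₀ (hbot z₀)).symm
    rw [ht, top_le_iff] at this
    exact EReal.coe_ne_top _ this
  have e := (EReal.coe_toReal htop (hbot u₀)).symm
  refine mem_subdiff_of_real hbot e fun z s hz => ?_
  have := key z s hz
  rw [e, EReal.coe_le_coe_iff] at this
  linarith

/-- First-order optimality condition of a proximal step (with a possibly indefinite matrix). -/
theorem mem_subdiff_of_isMinOn {n : ℕ} {f : Vec n → EReal} (hf : ProperClosedConvex f)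
    {M : Matrix (Fin n) (Fin n) ℝ} (hM : M.IsHermitian) {c x₀ x : Vec n}
    (h : IsMinOn (fun u : Vec n => f u + ((inner ℝ c u + 1 / 2 * sqForm M (u - x₀) : ℝ) : EReal))
      Set.univ x) : -c - mulV M (x - x₀) ∈ subdiff f x := by
  obtain ⟨hbot, ⟨z₀, hz₀⟩, -, hconv⟩ := hf
  have hmin := fun u => isMinOn_univ_iff.mp h u
  have htop : f x ≠ ⊤ := fun ht => by
    have := hmin z₀
    simp only [ht] at this
    rw [EReal.top_add_coe, ← EReal.coe_toReal hz₀ (hbot z₀), ← EReal.coe_add, top_le_iff] at this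
    exact EReal.coe_ne_top _ this
  have e := (EReal.coe_toReal htop (hbot x)).symm
  refine mem_subdiff_of_real hbot e fun z s hz => ?_
  set r := (f x).toReal
  set q := sqForm M (z - x)
  set i := inner ℝ c (z - x) + inner ℝ (mulV M (x - x₀)) (z - x)
  -- The quadratic term may be nonconvex, so minimality is tested only along the segment towards
  -- `z`. There this term is of second order in `t` and disappears after division by `t` and `t →
  -- 0`.
  have step : ∀ t : ℝ, 0 < t → t < 1 → 0 ≤ s - r + i + t * (1 / 2 * q) := by
    intro t ht0 ht1
    have hcv : f (x + t • (z - x)) ≤ (((1 - t) * r + t * s : ℝ) : EReal) := by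
      have := hconv (x := (x, r)) (by simp [e]) (y := (z, s)) (by simp [hz])
        (a := 1 - t) (b := t) (by linarith) ht0.le (by ring)
      have e2 : x + t • (z - x) = (1 - t) • x + t • z := by module
      rw [e2]
      simpa using this
    have hm := (hmin (x + t • (z - x))).trans (add_le_add_left hcv _)
    rw [e] at hm
    norm_cast at hm
    have e3 : x + t • (z - x) - x₀ = (x - x₀) + t • (z - x) := by module
    rw [e3, sqForm_add hM, sqForm_smul, inner_add_right, inner_smul_right, inner_smul_right] at hm
    have : 0 ≤ t * (s - r + i + t * (1 / 2 * q)) := by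
      simp only [i, q]
      nlinarith
    exact nonneg_of_mul_nonneg_right this ht0
  have lim : Tendsto (fun t : ℝ => s - r + i + t * (1 / 2 * q)) (𝓝[>] 0)
      (𝓝 (s - r + i + 0 * (1 / 2 * q))) :=
    ((by fun_prop : Continuous fun t : ℝ => s - r + i + t * (1 / 2 * q)).tendsto 0).mono_left
      nhdsWithin_le_nhds
  have := ge_of_tendsto lim (by
    filter_upwards [Ioo_mem_nhdsGT (show (0 : ℝ) < 1 by norm_num)] with t ht
    exact step t ht.1 ht.2)
  simp only [inner_sub_left, inner_neg_left, i] at *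
  linarith

/-! ### Saddle points and the optimality system -/

theorem lagrangian_real {n m : ℕ} {f : Vec n → EReal} {g : Vec m → EReal}
    {K : Matrix (Fin m) (Fin n) ℝ} {x : Vec n} {y : Vec m} {r s : ℝ} (hx : f x = r)
    (hy : conj g y = s) : lagrangian f g K x y = ((r + inner ℝ (mulV K x) y - s : ℝ) : EReal) := by
  rw [lagrangian, hx, hy]
  norm_cast

/-- Saddle points are the solutions of the optimality system. -/
theorem isSaddle_iff {n m : ℕ} {f : Vec n → EReal} {g : Vec m → EReal}
    {K : Matrix (Fin m) (Fin n) ℝ} (hf : ∀ x, f x ≠ ⊥) (hg : ∀ y, conj g y ≠ ⊥)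
    {x : Vec n} {y : Vec m} :
    IsSaddle f g K x y ↔ -mulV Kᵀ y ∈ subdiff f x ∧ mulV K x ∈ subdiff (conj g) y := by
  constructor
  · rintro ⟨hx, hy, h1, h2⟩
    have ex := (EReal.coe_toReal hx (hf x)).symm
    have ey := (EReal.coe_toReal hy (hg y)).symm
    refine ⟨mem_subdiff_of_real hf ex fun z s hz => ?_, mem_subdiff_of_real hg ey fun z s hz => ?_⟩
    · have := h2 z
      rw [lagrangian_real ex ey, lagrangian_real hz ey, EReal.coe_le_coe_iff, inner_mulV_left,
        inner_mulV_left] at this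
      rw [inner_neg_left, inner_sub_right, real_inner_comm, real_inner_comm _ (mulV Kᵀ y)]
      linarith
    · have := h1 z
      rw [lagrangian_real ex ey, lagrangian_real ex hz, EReal.coe_le_coe_iff] at this
      rw [inner_sub_right]
      linarith
  · rintro ⟨h1, h2⟩
    have ex := (EReal.coe_toReal h1.1 (hf x)).symm
    have ey := (EReal.coe_toReal h2.1 (hg y)).symm
    refine ⟨h1.1, h2.1, fun z => ?_, fun z => ?_⟩
    · rcases eq_or_ne (conj g z) ⊤ with hz | hz
      · simp [lagrangian, hz]
      · have ez := (EReal.coe_toReal hz (hg z)).symm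
        have := subdiff_real h2 ey ez
        rw [lagrangian_real ex ey, lagrangian_real ex ez, EReal.coe_le_coe_iff]
        rw [inner_sub_right] at this
        linarith
    · rcases eq_or_ne (f z) ⊤ with hz | hz
      · rw [lagrangian, lagrangian, hz, ey, EReal.top_add_coe, EReal.top_sub_coe]
        exact le_top
      · have ez := (EReal.coe_toReal hz (hf z)).symm
        have := subdiff_real h1 ex ez
        rw [lagrangian_real ex ey, lagrangian_real ez ey, EReal.coe_le_coe_iff, inner_mulV_left,
          inner_mulV_left]
        rw [inner_neg_left, inner_sub_right, real_inner_comm, real_inner_comm _ (mulV Kᵀ y)] at this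
        linarith

/-! ### Lyapunov analysis -/

theorem isHermitian_of_add_smul {n : ℕ} {S M : Matrix (Fin n) (Fin n) ℝ} (hS : S.IsHermitian)
    (h : (M + (1 / 2 : ℝ) • S).IsHermitian) : M.IsHermitian := by
  have h1 : ((1 / 2 : ℝ) • S).IsHermitian := by
    rw [Matrix.IsHermitian, Matrix.conjTranspose_smul, hS.eq]; simp
  simpa using h.sub h1

/-- Optimality conditions of a run of the method. -/
theorem IsRun.mem_subdiff {n m : ℕ} {f : Vec n → EReal} {g : Vec m → EReal}
    {K : Matrix (Fin m) (Fin n) ℝ} {M₁ : Matrix (Fin n) (Fin n) ℝ}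
    {M₂ : Matrix (Fin m) (Fin m) ℝ} (hf : ProperClosedConvex f) (hg : ProperClosedConvex (conj g))
    (hM₁ : M₁.IsHermitian) (hM₂ : M₂.IsHermitian) {x : ℕ → Vec n} {y : ℕ → Vec m}
    (h : IsRun f g K M₁ M₂ x y) (k : ℕ) :
    -mulV Kᵀ (y k) - mulV M₁ (x (k + 1) - x k) ∈ subdiff f (x (k + 1)) ∧
      mulV K ((2 : ℝ) • x (k + 1) - x k) - mulV M₂ (y (k + 1) - y k)
        ∈ subdiff (conj g) (y (k + 1)) := by
  obtain ⟨h1, h2⟩ := h k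
  constructor
  · refine mem_subdiff_of_isMinOn hf hM₁ ?_
    simpa only [inner_mulV_left, real_inner_comm (mulV Kᵀ (y k))] using h1
  · have := mem_subdiff_of_isMinOn hg hM₂ (c := -mulV K ((2 : ℝ) • x (k + 1) - x k))
      (by simpa only [inner_neg_left] using h2)
    simpa using this

/-- Descent of the distance to a saddle point, for one step of the method in the variables
`X = xᵏ⁺¹` and `l = yᵏ + L (xᵏ⁺¹ - xᵏ)`, where `M₂ L = K`. -/
theorem dist_descent {n m : ℕ} {K L : Matrix (Fin m) (Fin n) ℝ} {S M₁ : Matrix (Fin n) (Fin n) ℝ}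
    {M₂ : Matrix (Fin m) (Fin m) ℝ} (hM₁ : M₁.IsHermitian) (hM₂ : M₂.IsHermitian)
    (hS : S.PosSemidef) (hL : M₂ * L = K) {X X' xs : Vec n} {l l' ys : Vec m} {y' : Vec m}
    (hy' : y' = l' - mulV L (X' - X))
    (hF : sqForm S (X' - xs) ≤
      inner ℝ ((-mulV Kᵀ y' - mulV M₁ (X' - X)) - -mulV Kᵀ ys) (X' - xs))
    (hG : 0 ≤ inner ℝ ((mulV K X + mulV M₂ (l - y')) - mulV K xs) (y' - ys)) :
    sqForm (M₁ + S) (X' - xs) + sqForm M₂ (l' - ys) + sqForm (M₁ + (1 / 2 : ℝ) • S) (X' - X)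
        + sqForm M₂ (l' - l) - 2 * inner ℝ (l' - l) (mulV K (X' - X))
      ≤ sqForm (M₁ + S) (X - xs) + sqForm M₂ (l - ys) := by
  have hK : ∀ v, mulV K v = mulV M₂ (mulV L v) := fun v => by rw [← hL, mulV_mul]
  have hF' : sqForm S (X' - xs) ≤ -inner ℝ (mulV K (X' - xs)) (y' - ys)
      - inner ℝ (mulV M₁ (X' - X)) (X' - xs) := by
    rw [inner_mulV_left, real_inner_comm, mulV_sub Kᵀ]
    refine hF.trans (le_of_eq ?_)
    simp only [inner_sub_left, inner_neg_left]
    ring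
  have hG' : 0 ≤ inner ℝ (mulV K (X' - xs)) (y' - ys) - inner ℝ (mulV M₂ (l' - l)) (y' - ys) := by
    refine hG.trans (le_of_eq ?_)
    rw [← inner_sub_left]
    congr 1
    subst hy'
    simp only [hK, mulV_sub]
    abel
  have e1 := two_inner_mulV_sub hM₁ (X' - xs) (X - xs)
  have e2 := two_inner_mulV_sub hM₂ (l' - ys) (l - ys)
  -- After doubling, `2‖X' - xs‖²_S` is available. One copy joins the new distance; the other
  -- dominates `½‖X' - X‖²_S - ‖X - xs‖²_S`. Thus `M₁` becomes `M₁ + S` in the distances and `M₁ +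
  -- S/2` in the step.
  have e3 := sqForm_sub_le hS (X' - xs) (X - xs)
  rw [sub_sub_sub_cancel_right] at e1 e2 e3
  have e4 : y' - ys = (l' - ys) - mulV L (X' - X) := by rw [hy']; abel
  have e5 : inner ℝ (mulV M₂ (l' - l)) (mulV L (X' - X)) =
      (inner ℝ (l' - l) (mulV K (X' - X)) : ℝ) := by
    rw [inner_mulV_comm hM₂, hK, real_inner_comm]
  have e6 : inner ℝ (mulV M₂ (l' - l)) (y' - ys) = (inner ℝ (mulV M₂ (l' - l)) (l' - ys) : ℝ)
      - inner ℝ (l' - l) (mulV K (X' - X)) := by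
    rw [e4, inner_sub_right, e5]
  simp only [sqForm_add_matrix, sqForm_smul_matrix]
  linarith

/-- Control of the cross term by monotonicity of the subdifferential at consecutive iterates. -/
theorem cross_term_le {n m : ℕ} {K L : Matrix (Fin m) (Fin n) ℝ} {S M₁ : Matrix (Fin n) (Fin n) ℝ}
    {M₂ : Matrix (Fin m) (Fin m) ℝ} (hM₁ : M₁.IsHermitian) (hM₂ : M₂.IsHermitian)
    (hS : S.PosSemidef) (hA : (M₁ + (1 / 2 : ℝ) • S).PosSemidef) (hL : M₂ * L = K) {ε : ℝ}
    (hε : 0 ≤ ε)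
    (hLA : ∀ v, sqForm M₂ (mulV L v) ≤ (1 + ε) * sqForm (M₁ + (1 / 2 : ℝ) • S) v)
    {p p' : Vec n} {d d' : Vec m} (hd : d = d' - mulV L (p' - p))
    (hF : sqForm S p' ≤ inner ℝ (-mulV Kᵀ d - mulV M₁ (p' - p)) p') :
    1 / 2 * sqForm (M₁ + S) p' - 1 / 2 * sqForm M₂ (mulV L p')
        + ε * sqForm (M₁ + (1 / 2 : ℝ) • S) p' + inner ℝ d' (mulV K p')
      ≤ 1 / 2 * sqForm (M₁ + S) p - 1 / 2 * sqForm M₂ (mulV L p)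
        + ε * sqForm (M₁ + (1 / 2 : ℝ) • S) p
        + 2 * ε * sqForm (M₁ + (1 / 2 : ℝ) • S) p' := by
  have hK : ∀ v, mulV K v = mulV M₂ (mulV L v) := fun v => by rw [← hL, mulV_mul]
  have hF' : sqForm S p' ≤ -inner ℝ d' (mulV K p')
      + inner ℝ (mulV M₂ (mulV L p' - mulV L p)) (mulV L p') - inner ℝ (mulV M₁ (p' - p)) p' := by
    refine hF.trans (le_of_eq ?_)
    rw [inner_sub_left, inner_neg_left, real_inner_comm p', ← inner_mulV_left, hd, inner_sub_right,
      real_inner_comm d', inner_mulV_comm hM₂, hK, mulV_sub L]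
    ring
  have e1 := two_inner_mulV_sub hM₁ p' p
  have e2 := two_inner_mulV_sub hM₂ (mulV L p') (mulV L p)
  have e3 := sqForm_sub_le hS p' p
  -- Half of `‖L (p' - p)‖²_{M₂}` exceeds the available `½‖p' - p‖²_A` by at most `(ε/2)‖p' -
  -- p‖²_A`. This is split into `ε‖p'‖²_A + ε‖p‖²_A`; adding `ε‖p'‖²_A` to both sides makes the
  -- estimate telescope.
  have e4 := sqForm_sub_le hA p' p
  have e5 := hLA (p' - p)
  rw [mulV_sub] at e5
  have e6 := mul_le_mul_of_nonneg_left e4 hε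
  have e7 := sqForm_add_matrix M₁ ((1 / 2 : ℝ) • S) (p' - p)
  rw [sqForm_smul_matrix] at e7
  have e8 := sqForm_add_matrix M₁ S p
  have e9 := sqForm_add_matrix M₁ S p'
  nlinarith

/-- Expand `‖t L p - d‖²_{M₂} ≥ 0`. It is used with `t = 1 - θ` for the descent and with `t = 2` to
recover control of `d`. -/
theorem cross_term_young {n m : ℕ} {K L : Matrix (Fin m) (Fin n) ℝ}
    {M₂ : Matrix (Fin m) (Fin m) ℝ} (hM₂ : M₂.PosSemidef) (hL : M₂ * L = K) (t : ℝ)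
    (p : Vec n) (d : Vec m) :
    2 * t * inner ℝ d (mulV K p) ≤ sqForm M₂ d + t ^ 2 * sqForm M₂ (mulV L p) := by
  have h := sqForm_nonneg hM₂ (t • mulV L p - d)
  rw [sqForm_sub hM₂.isHermitian, sqForm_smul, mulV_smul, ← mulV_mul, hL, inner_smul_left,
    real_inner_comm] at h
  simp only [conj_trivial] at h
  linarith

/-- A nonnegative sequence that is dominated by the decrements of a sequence that is bounded
below tends to zero. -/
theorem tendsto_zero_of_descent {W a : ℕ → ℝ} {c : ℝ} (hc : 0 < c) (hW : ∀ k, 0 ≤ W k)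
    (ha : ∀ k, 0 ≤ a k) (h : ∀ k, W (k + 1) + c * a k ≤ W k) :
    (∃ w, Tendsto W atTop (𝓝 w)) ∧ Tendsto a atTop (𝓝 0) := by
  have hanti : Antitone W := antitone_nat_of_succ_le fun k => by
    have := mul_nonneg hc.le (ha k)
    linarith [h k]
  have hbdd : BddBelow (Set.range W) := ⟨0, by rintro _ ⟨k, rfl⟩; exact hW k⟩
  have hlim := tendsto_atTop_ciInf hanti hbdd
  refine ⟨⟨_, hlim⟩, ?_⟩
  have h1 := ((hlim.sub ((tendsto_add_atTop_iff_nat 1).mpr hlim)).div_const c)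
  rw [sub_self, zero_div] at h1
  refine squeeze_zero ha (fun k => ?_) h1
  rw [le_div_iff₀ hc]
  linarith [h k]

theorem tendsto_zero_of_sqForm {n : ℕ} {A : Matrix (Fin n) (Fin n) ℝ} (hA : A.PosDef)
    {p : ℕ → Vec n} (h : Tendsto (fun k => sqForm A (p k)) atTop (𝓝 0)) :
    Tendsto p atTop (𝓝 0) := by
  obtain ⟨C, hC⟩ := exists_norm_sq_le_sqForm hA
  rw [tendsto_zero_iff_norm_tendsto_zero]
  have h1 : Tendsto (fun k => ‖p k‖ ^ 2) atTop (𝓝 0) :=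
    squeeze_zero (fun _ => sq_nonneg _) (fun k => hC (p k)) (by simpa using h.const_mul C)
  simpa using h1.sqrt

theorem bounded_of_sqForm {n : ℕ} {A : Matrix (Fin n) (Fin n) ℝ} (hA : A.PosDef)
    {p : ℕ → Vec n} {b : ℝ} (h : ∀ k, sqForm A (p k) ≤ b) : ∃ R, ∀ k, ‖p k‖ ≤ R := by
  obtain ⟨C, hC⟩ := exists_norm_sq_le_sqForm hA
  refine ⟨√(|C| * b), fun k => Real.le_sqrt_of_sq_le ((hC (p k)).trans ?_)⟩
  exact (mul_le_mul_of_nonneg_right (le_abs_self C) (sqForm_nonneg hA.posSemidef _)).trans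
    (mul_le_mul_of_nonneg_left (h k) (abs_nonneg C))

/-- Convergence of a run of the method when the norm bound is at most `1 + ε` with `ε < 1/3`. -/
theorem IsRun.converges_to_saddle {n m : ℕ} {f : Vec n → EReal} {g : Vec m → EReal}
    {K : Matrix (Fin m) (Fin n) ℝ} {S M₁ : Matrix (Fin n) (Fin n) ℝ}
    {M₂ : Matrix (Fin m) (Fin m) ℝ} {ρ ε : ℝ} (h : Admissible f g K S M₁ M₂ ρ) (hρ : ρ ≤ 1 + ε)
    (hε : 0 ≤ ε) (hε' : ε < 1 / 3) {x : ℕ → Vec n} {y : ℕ → Vec m}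
    (hrun : IsRun f g K M₁ M₂ x y) :
    ∃ (xs : Vec n) (ys : Vec m), IsSaddle f g K xs ys ∧
      Tendsto (fun k => (x k, y k)) atTop (𝓝 (xs, ys)) := by
  obtain ⟨hf, hg, ⟨hS, hmono⟩, ⟨x₀, y₀, hs₀⟩, hstep⟩ := h
  have hA := hstep.1
  have hB := hstep.2.1
  have hconj := hg.conj ⟨y₀, hs₀.2.1⟩
  have hM₁ := isHermitian_of_add_smul hS.isHermitian hA.isHermitian
  have hQ : (M₁ + S).PosDef := by
    have h1 : ((1 / 2 : ℝ) • S).PosSemidef := hS.smul (by norm_num)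
    have := hA.add_posSemidef h1
    rwa [add_assoc, ← add_smul, add_halves, one_smul] at this
  set A := M₁ + (1 / 2 : ℝ) • S with hAdef
  set L := M₂⁻¹ * K with hLdef
  have hL : M₂ * L = K := by
    rw [hLdef, ← Matrix.mul_assoc, Matrix.mul_nonsing_inv _ hB.det_pos.ne'.isUnit, Matrix.one_mul]
  have hLA : ∀ v, sqForm M₂ (mulV L v) ≤ (1 + ε) * sqForm A v := fun v =>
    (hstep.sqForm_le v).trans (mul_le_mul_of_nonneg_right hρ (sqForm_nonneg hA.posSemidef v))
  have hrun' := hrun.mem_subdiff hf hconj hM₁ hB.isHermitian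
  have hK : ∀ v, mulV K v = mulV M₂ (mulV L v) := fun v => by rw [← hL, mulV_mul]
  have hQA : ∀ v, sqForm A v ≤ sqForm (M₁ + S) v := fun v => by
    have := sqForm_nonneg hS v
    simp only [hAdef, sqForm_add_matrix, sqForm_smul_matrix]
    linarith
  set p : ℕ → Vec n := fun k => x (k + 1) - x k with hp
  set l : ℕ → Vec m := fun k => y k + mulV L (p k) with hl
  set φ : Vec n → ℝ := fun v =>
    1 / 2 * sqForm (M₁ + S) v - 1 / 2 * sqForm M₂ (mulV L v) + ε * sqForm A v with hφ
  -- The summand `ε‖v‖²_A` in `φ` compensates for a norm bound larger than `1`.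
  have hφ0 : ∀ v, 0 ≤ φ v := fun v => by
    have h1 := hLA v
    have h2 := hQA v
    have h3 := mul_nonneg hε (sqForm_nonneg hA.posSemidef v)
    simp only [hφ]
    linarith
  have hφc : Continuous φ := by
    have := continuous_sqForm A
    have := continuous_sqForm (M₁ + S)
    have := (continuous_sqForm M₂).comp (continuous_mulV L)
    simp only [Function.comp_def] at this
    fun_prop
  have hφz : φ 0 = 0 := by
    simp [hφ, sqForm_zero, mulV]
  have hsad := fun xs ys => isSaddle_iff (K := K) hf.1 hconj.1 (x := xs) (y := ys)
  set V : Vec n → Vec m → ℕ → ℝ := fun xs ys k =>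
    sqForm (M₁ + S) (x (k + 1) - xs) + sqForm M₂ (l k - ys) with hV
  have hV0 : ∀ xs ys k, 0 ≤ V xs ys k := fun xs ys k =>
    add_nonneg (sqForm_nonneg hQ.posSemidef _) (sqForm_nonneg hB.posSemidef _)
  have hdist : ∀ xs ys, IsSaddle f g K xs ys → ∀ k, V xs ys (k + 1) + sqForm A (p (k + 1))
      + sqForm M₂ (l (k + 1) - l k) - 2 * inner ℝ (l (k + 1) - l k) (mulV K (p (k + 1)))
      ≤ V xs ys k := by
    intro xs ys hxy k
    obtain ⟨hx, hy⟩ := (hsad xs ys).mp hxy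
    -- The primal inclusion of step `k + 1` is paired with the dual inclusion of step `k`, since
    -- both involve `y (k + 1)`.
    refine dist_descent hM₁ hB.isHermitian hS hL (y' := y (k + 1)) (by simp [hl, hp])
      (hmono _ _ _ (hrun' (k + 1)).1 _ hx) ?_
    have := subdiff_monotone hconj.1 (hrun' k).2 hy
    convert this using 4
    simp only [hl, hp, mulV_sub, mulV_add, mulV_smul, hK]
    module
  have hcross : ∀ k, φ (p (k + 1)) + inner ℝ (l (k + 1) - l k) (mulV K (p (k + 1)))
      ≤ φ (p k) + 2 * ε * sqForm A (p (k + 1)) := by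
    intro k
    refine cross_term_le (d := y (k + 1) - y k) hM₁ hB.isHermitian hS hA.posSemidef hL hε hLA ?_ ?_
    · simp only [hl, mulV_sub]
      abel
    · refine (hmono _ _ _ (hrun' (k + 1)).1 _ (hrun' k).1).trans (le_of_eq ?_)
      congr 1
      simp only [hp, mulV_sub]
      abel
  -- This `θ` maximizes the coefficient `1 - 4θε - (1 - θ)²(1 + ε)` left in front of `‖p‖²_A`; the
  -- maximum is `c`.
  set θ := (1 - ε) / (1 + ε) with hθ
  have hθ0 : 0 ≤ θ := div_nonneg (by linarith) (by linarith)
  set c := (1 - 3 * ε) / (1 + ε) with hc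
  have hc0 : 0 < c := div_pos (by linarith) (by linarith)
  have hcθ : c = 1 - 4 * θ * ε - (1 - θ) ^ 2 * (1 + ε) := by
    rw [hc, hθ]
    field_simp
    ring
  set W : Vec n → Vec m → ℕ → ℝ := fun xs ys k => V xs ys k + 2 * θ * φ (p k) with hW
  have hVW : ∀ xs ys k, V xs ys k ≤ W xs ys k := fun xs ys k =>
    le_add_of_nonneg_right (mul_nonneg (by linarith) (hφ0 _))
  have hdesc : ∀ xs ys, IsSaddle f g K xs ys →
      ∀ k, W xs ys (k + 1) + c * sqForm A (p (k + 1)) ≤ W xs ys k := by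
    intro xs ys hxy k
    have h1 := hdist xs ys hxy k
    have h2 := mul_le_mul_of_nonneg_left (hcross k) hθ0
    have h3 := cross_term_young hB.posSemidef hL (1 - θ) (p (k + 1)) (l (k + 1) - l k)
    have h4 := mul_le_mul_of_nonneg_left (hLA (p (k + 1))) (sq_nonneg (1 - θ))
    simp only [hW, hcθ]
    nlinarith
  have hlimW := fun xs ys hxy => tendsto_zero_of_descent hc0
    (fun k => (hV0 xs ys k).trans (hVW xs ys k))
    (fun k => sqForm_nonneg hA.posSemidef (p (k + 1))) (hdesc xs ys hxy)
  have hpA : Tendsto (fun k => sqForm A (p (k + 1))) atTop (𝓝 0) := (hlimW x₀ y₀ hs₀).2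
  have hp0 : Tendsto p atTop (𝓝 0) :=
    (tendsto_add_atTop_iff_nat 1).mp (tendsto_zero_of_sqForm hA hpA)
  have hφp : Tendsto (fun k => 2 * θ * φ (p k)) atTop (𝓝 0) := by
    have := ((hφc.tendsto 0).comp hp0).const_mul (2 * θ)
    rwa [hφz, mul_zero] at this
  have hlimV : ∀ xs ys, IsSaddle f g K xs ys → ∃ w, Tendsto (V xs ys) atTop (𝓝 w) := by
    intro xs ys hxy
    obtain ⟨w, hw⟩ := (hlimW xs ys hxy).1
    refine ⟨w, ?_⟩
    have := hw.sub hφp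
    simpa [hW] using this
  -- The descent of `W` spends all of `‖l (k+1) - l k‖²_{M₂}` on Young's inequality. Hence
  -- `dist_descent` is used again, now with only half of that term spent, since `V` is already known
  -- to converge and `‖p‖²_A` to vanish.
  have hlB : Tendsto (fun k => sqForm M₂ (l (k + 1) - l k)) atTop (𝓝 0) := by
    obtain ⟨w, hw⟩ := hlimV x₀ y₀ hs₀
    have hbound : Tendsto (fun k => 2 * (V x₀ y₀ k - V x₀ y₀ (k + 1))
        + 4 * (1 + ε) * sqForm A (p (k + 1))) atTop (𝓝 0) := by
      have := ((hw.sub ((tendsto_add_atTop_iff_nat 1).mpr hw)).const_mul 2).add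
        (hpA.const_mul (4 * (1 + ε)))
      simpa using this
    refine squeeze_zero (fun k => sqForm_nonneg hB.posSemidef _) (fun k => ?_) hbound
    have h1 := hdist x₀ y₀ hs₀ k
    have h2 := cross_term_young hB.posSemidef hL 2 (p (k + 1)) (l (k + 1) - l k)
    have h3 := hLA (p (k + 1))
    have h4 := sqForm_nonneg hA.posSemidef (p (k + 1))
    linarith
  have hl0 : Tendsto (fun k => l (k + 1) - l k) atTop (𝓝 0) := tendsto_zero_of_sqForm hB hlB
  have hanti : Antitone (W x₀ y₀) := antitone_nat_of_succ_le fun k => by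
    have := mul_nonneg hc0.le (sqForm_nonneg hA.posSemidef (p (k + 1)))
    linarith [hdesc x₀ y₀ hs₀ k]
  have hVb : ∀ k, V x₀ y₀ k ≤ W x₀ y₀ 0 := fun k => (hVW _ _ k).trans (hanti (Nat.zero_le k))
  obtain ⟨R₁, hR₁⟩ := bounded_of_sqForm hQ (p := fun k => x (k + 1) - x₀) (b := W x₀ y₀ 0)
    fun k => (le_add_of_nonneg_right (sqForm_nonneg hB.posSemidef _)).trans (hVb k)
  obtain ⟨R₂, hR₂⟩ := bounded_of_sqForm hB (p := fun k => l k - y₀) (b := W x₀ y₀ 0)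
    fun k => (le_add_of_nonneg_left (sqForm_nonneg hQ.posSemidef _)).trans (hVb k)
  obtain ⟨⟨xs, ys⟩, -, σ, hσ, hlim⟩ := tendsto_subseq_of_bounded
    (s := Metric.closedBall x₀ R₁ ×ˢ Metric.closedBall y₀ R₂)
    (Metric.isBounded_closedBall.prod Metric.isBounded_closedBall)
    (x := fun k => (x (k + 1), l k)) fun k => by
      simpa [dist_eq_norm] using And.intro (hR₁ k) (hR₂ k)
  have hlx : Tendsto (fun k => x (σ k + 1)) atTop (𝓝 xs) :=
    (continuous_fst.tendsto (xs, ys)).comp hlim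
  have hll : Tendsto (fun k => l (σ k)) atTop (𝓝 ys) :=
    (continuous_snd.tendsto (xs, ys)).comp hlim
  have hσt := hσ.tendsto_atTop
  have hmul : ∀ {a b : ℕ} (M : Matrix (Fin a) (Fin b) ℝ) {u : ℕ → Vec b} {u₀ : Vec b},
      Tendsto u atTop (𝓝 u₀) → Tendsto (fun k => mulV M (u k)) atTop (𝓝 (mulV M u₀)) :=
    fun M _ _ hu => ((continuous_mulV M).tendsto _).comp hu
  have hm0 : ∀ {a b : ℕ} (M : Matrix (Fin a) (Fin b) ℝ), mulV M 0 = 0 := fun M => by simp [mulV]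
  have hly : ∀ {u : ℕ → ℕ} {q : Vec m}, Tendsto u atTop atTop →
      Tendsto (fun k => l (u k)) atTop (𝓝 q) → Tendsto (fun k => y (u k)) atTop (𝓝 q) := by
    intro u q hu hq
    have := hq.sub (hmul L (hp0.comp hu))
    simpa [hl, hm0] using this
  have hyσ := hly hσt hll
  have hyσ' : Tendsto (fun k => y (σ k + 1)) atTop (𝓝 ys) := by
    refine hly (u := fun k => σ k + 1) ((tendsto_add_atTop_nat 1).comp hσt) ?_
    have := (hl0.comp hσt).add hll
    simpa using this
  have hsaddle : IsSaddle f g K xs ys := by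
    rw [hsad]
    constructor
    · refine subdiff_closed hf hlx (ξ := fun k => _) ?_ fun k => (hrun' (σ k)).1
      have := (hmul Kᵀ hyσ).neg.sub (hmul M₁ (hp0.comp hσt))
      simpa [hm0] using this
    · refine subdiff_closed hconj hyσ' (ξ := fun k => _) ?_ fun k => (hrun' (σ k)).2
      have h1 : Tendsto (fun k => (2 : ℝ) • x (σ k + 1) - x (σ k)) atTop (𝓝 xs) := by
        have := hlx.add (hp0.comp hσt)
        rw [add_zero] at this
        refine this.congr fun k => ?_
        simp only [hp, Function.comp_apply]
        module
      have := (hmul K h1).sub (hmul M₂ (hyσ'.sub hyσ))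
      simpa [hm0] using this
  refine ⟨xs, ys, hsaddle, ?_⟩
  obtain ⟨w, hw⟩ := hlimV xs ys hsaddle
  -- `V` about the cluster point has a limit along the full sequence, and it vanishes along the
  -- subsequence.
  have hw0 : w = 0 := by
    refine tendsto_nhds_unique (hw.comp hσt) ?_
    have h1 := ((continuous_sqForm (M₁ + S)).tendsto _).comp (hlx.sub_const xs)
    have h2 := ((continuous_sqForm M₂).tendsto _).comp (hll.sub_const ys)
    have := h1.add h2
    simpa [hV, Function.comp_def, sqForm_zero] using this
  subst hw0
  have hx0 : Tendsto (fun k => x (k + 1) - xs) atTop (𝓝 0) := tendsto_zero_of_sqForm hQ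
    (squeeze_zero (fun k => sqForm_nonneg hQ.posSemidef _)
      (fun k => le_add_of_nonneg_right (sqForm_nonneg hB.posSemidef _)) hw)
  have hy0 : Tendsto (fun k => l k - ys) atTop (𝓝 0) := tendsto_zero_of_sqForm hB
    (squeeze_zero (fun k => sqForm_nonneg hB.posSemidef _)
      (fun k => le_add_of_nonneg_left (sqForm_nonneg hQ.posSemidef _)) hw)
  refine Tendsto.prodMk_nhds ((tendsto_add_atTop_iff_nat 1).mp ?_) (hly (u := fun k => k)
    tendsto_id ?_)
  · simpa using hx0.add_const xs
  · simpa using hy0.add_const ys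

/-! ### The bilinear problem -/

theorem inner_vec_one (p q : Vec 1) : (inner ℝ p q : ℝ) = p 0 * q 0 := by
  simp [EuclideanSpace.inner_eq_star_dotProduct, mul_comm, dotProduct]

theorem sqForm_smul_one {n : ℕ} (t : ℝ) (p : Vec n) :
    sqForm (t • (1 : Matrix (Fin n) (Fin n) ℝ)) p = t * inner ℝ p p := by
  rw [sqForm, smul_mulV, mulV_one, inner_smul_right]

theorem vec_one_ext {p q : Vec 1} (h : p 0 = q 0) : p = q := by
  ext i
  rwa [Fin.eq_zero i]

theorem conj_bilinG (y : Vec 1) : conj bilinG y = 0 := by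
  refine le_antisymm (conj_le_iff.mpr fun z => ?_) ?_
  · by_cases hz : z = 0
    · simp [bilinG, hz]
    · simp [bilinG, hz]
  · refine le_trans ?_ (conj_le_iff.mp le_rfl 0)
    simp [bilinG]

theorem lagrangian_bilin (p q : Vec 1) :
    lagrangian bilinF bilinG 1 p q = ((p 0 * q 0 : ℝ) : EReal) := by
  simp [lagrangian, bilinF, conj_bilinG, mulV_one, inner_vec_one]

theorem isSaddle_bilin_iff (p q : Vec 1) :
    IsSaddle bilinF bilinG 1 p q ↔ p = 0 ∧ q = 0 := by
  simp only [IsSaddle, lagrangian_bilin, conj_bilinG, bilinF, EReal.coe_le_coe_iff]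
  constructor
  · rintro ⟨-, -, h1, h2⟩
    -- These test points give `(p 0)² ≤ 0` and `(q 0)² ≤ 0`.
    have a1 := h1 (q + p)
    have a2 := h2 (p - q)
    simp only [PiLp.add_apply, PiLp.sub_apply] at a1 a2
    constructor <;> refine vec_one_ext ?_ <;> simp only [PiLp.zero_apply] <;> nlinarith
  · rintro ⟨rfl, rfl⟩
    simp

theorem properClosedConvex_bilinF : ProperClosedConvex bilinF := by
  refine ⟨by simp [bilinF], ⟨0, by simp [bilinF]⟩, ?_, ?_⟩
  · exact (continuous_const (y := (0 : EReal))).lowerSemicontinuous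
  · rintro ⟨x, r⟩ hr ⟨y, s⟩ hs a b ha hb -
    simp only [bilinF, Set.mem_ofPred_eq, EReal.coe_nonneg] at *
    exact add_nonneg (mul_nonneg ha hr) (mul_nonneg hb hs)

theorem bilinG_le_coe_iff {z : Vec 1} {r : ℝ} : bilinG z ≤ r ↔ z = 0 ∧ 0 ≤ r := by
  by_cases hz : z = 0
  · simp [bilinG, hz]
  · simp [bilinG, hz]

theorem properClosedConvex_bilinG : ProperClosedConvex bilinG := by
  refine ⟨fun x => ?_, ⟨0, by simp [bilinG]⟩, fun x c hc => ?_, ?_⟩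
  · unfold bilinG
    split_ifs <;> simp
  · by_cases hx : x = 0
    · refine Eventually.of_forall fun z => lt_of_lt_of_le hc ?_
      by_cases hz : z = 0 <;> simp [bilinG, hx, hz]
    · filter_upwards [isOpen_ne.mem_nhds hx] with z hz
      have hz' : z ≠ 0 := hz
      simpa [bilinG, hx, hz'] using hc
  · rintro ⟨x, r⟩ hr ⟨y, s⟩ hs a b ha hb -
    simp only [Set.mem_ofPred_eq, bilinG_le_coe_iff, Prod.smul_mk, Prod.mk_add_mk] at *
    obtain ⟨rfl, hr⟩ := hr
    obtain ⟨rfl, hs⟩ := hs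
    exact ⟨by simp, add_nonneg (mul_nonneg ha hr) (mul_nonneg hb hs)⟩

theorem posDef_smul_one {n : ℕ} {t : ℝ} (ht : 0 < t) :
    (t • (1 : Matrix (Fin n) (Fin n) ℝ)).PosDef := Matrix.PosDef.one.smul ht

theorem sqrt_inv_inv_smul_one {n : ℕ} {t : ℝ} (ht : 0 < t) :
    CFC.sqrt (t⁻¹ • (1 : Matrix (Fin n) (Fin n) ℝ))⁻¹ = √t • 1 := by
  have h1 : (t⁻¹ • (1 : Matrix (Fin n) (Fin n) ℝ))⁻¹ = t • 1 := by
    refine Matrix.inv_eq_left_inv ?_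
    simp [smul_smul, ht.ne']
  rw [h1]
  refine CFC.sqrt_unique ?_ ?_
  · simp [smul_smul, Real.mul_self_sqrt ht.le]
  · exact (posDef_smul_one (Real.sqrt_pos.mpr ht)).posSemidef.nonneg

theorem admissible_bilin {τ σ ρ : ℝ} (hτ : 0 < τ) (hσ : 0 < σ) (h : τ * σ = 4 / 3)
    (hρ : 4 / 3 ≤ ρ) : Admissible bilinF bilinG 1 0 (τ⁻¹ • 1) (σ⁻¹ • 1) ρ := by
  refine ⟨properClosedConvex_bilinF, properClosedConvex_bilinG, ⟨Matrix.PosSemidef.zero, ?_⟩,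
    ⟨0, 0, (isSaddle_bilin_iff 0 0).mpr ⟨rfl, rfl⟩⟩, ?_, posDef_smul_one (inv_pos.mpr hσ), ?_⟩
  · intro x₁ x₂ ξ₁ h₁ ξ₂ h₂
    have := subdiff_monotone properClosedConvex_bilinF.1 h₁ h₂
    simpa [sqForm, mulV] using this
  · simpa using posDef_smul_one (n := 1) (inv_pos.mpr hτ)
  -- The preconditioned matrix is the scalar `√σ √τ`, with square `4/3`.
  · rw [smul_zero, add_zero, sqrt_inv_inv_smul_one hτ, sqrt_inv_inv_smul_one hσ, mul_one,
      smul_mul_smul_comm, one_mul, norm_smul, norm_one, mul_one, Real.norm_eq_abs, sq_abs, mul_pow,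
      Real.sq_sqrt hτ.le, Real.sq_sqrt hσ.le]
    linarith

/-- The minimizer of a strongly convex quadratic function of one real variable. -/
theorem isMinOn_quadratic_iff {c t : ℝ} (ht : 0 < t) (x₀ x : Vec 1) :
    IsMinOn (fun u : Vec 1 => ((c * u 0 + 1 / 2 * (t⁻¹ * ((u 0 - x₀ 0) * (u 0 - x₀ 0))) : ℝ) :
      EReal)) Set.univ x ↔ x 0 = x₀ 0 - t * c := by
  have key : ∀ v : ℝ, c * v + 1 / 2 * (t⁻¹ * ((v - x₀ 0) * (v - x₀ 0))) =
      1 / 2 * t⁻¹ * (v - (x₀ 0 - t * c)) ^ 2 + (c * x₀ 0 - 1 / 2 * t * c ^ 2) := by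
    intro v
    field_simp
    ring
  have ht' : 0 < 1 / 2 * t⁻¹ := by positivity
  simp only [isMinOn_univ_iff, EReal.coe_le_coe_iff, key, add_le_add_iff_right]
  constructor
  · intro h
    have := h (EuclideanSpace.single 0 (x₀ 0 - t * c))
    simp only [PiLp.single_apply, if_true, sub_self] at this
    have h2 : (x 0 - (x₀ 0 - t * c)) ^ 2 ≤ 0 := by
      by_contra! hlt
      have := mul_pos ht' hlt
      nlinarith
    have := pow_eq_zero_iff (two_ne_zero) |>.mp (le_antisymm h2 (sq_nonneg _))
    linarith
  · intro h u
    rw [h]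
    simp only [sub_self]
    have := mul_nonneg ht'.le (sq_nonneg (u 0 - (x₀ 0 - t * c)))
    simpa using this

theorem isRun_bilin_iff' {τ σ : ℝ} (hτ : 0 < τ) (hσ : 0 < σ) (x y : ℕ → Vec 1) :
    IsRun bilinF bilinG 1 (τ⁻¹ • 1) (σ⁻¹ • 1) x y ↔
      ∀ k, x (k + 1) 0 = x k 0 - τ * y k 0 ∧
        y (k + 1) 0 = y k 0 + σ * (2 * x (k + 1) 0 - x k 0) := by
  refine forall_congr' fun k => and_congr ?_ ?_
  · rw [← isMinOn_quadratic_iff hτ]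
    simp only [bilinF, zero_add, mulV_one, sqForm_smul_one, inner_vec_one, PiLp.sub_apply,
      mul_comm (y k 0)]
  · have := isMinOn_quadratic_iff (c := -(2 * x (k + 1) 0 - x k 0)) hσ (y k) (y (k + 1))
    rw [mul_neg, sub_neg_eq_add] at this
    rw [← this]
    simp only [conj_bilinG, zero_add, mulV_one, sqForm_smul_one, inner_vec_one, PiLp.sub_apply,
      PiLp.smul_apply, smul_eq_mul, neg_mul]

theorem isRun_bilin_iff {τ σ : ℝ} (hτ : 0 < τ) (hσ : 0 < σ) (x y : ℕ → Vec 1) :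
    IsRun bilinF bilinG 1 (τ⁻¹ • 1) (σ⁻¹ • 1) x y ↔
      ∀ k, ![x (k + 1) 0, y (k + 1) 0] = iterMatrix τ σ *ᵥ ![x k 0, y k 0] := by
  rw [isRun_bilin_iff' hτ hσ]
  refine forall_congr' fun k => ?_
  simp only [iterMatrix, Matrix.cons_mulVec, Matrix.cons_dotProduct, Matrix.dotProduct_of_isEmpty,
    Matrix.empty_mulVec, Matrix.vecCons_inj, and_true, Matrix.head_cons, Matrix.tail_cons]
  constructor
  · rintro ⟨h1, h2⟩
    refine ⟨by rw [h1]; ring, by rw [h2, h1]; ring⟩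
  · rintro ⟨h1, h2⟩
    refine ⟨by rw [h1]; ring, by rw [h2, h1]; ring⟩

theorem exists_isRun_bilin {τ σ : ℝ} (hτ : 0 < τ) (hσ : 0 < σ) (x₀ y₀ : Vec 1) :
    ∃ x y : ℕ → Vec 1, x 0 = x₀ ∧ y 0 = y₀ ∧
      IsRun bilinF bilinG 1 (τ⁻¹ • 1) (σ⁻¹ • 1) x y := by
  let step : Vec 1 × Vec 1 → Vec 1 × Vec 1 := fun p =>
    (p.1 - τ • p.2, p.2 + σ • ((2 : ℝ) • (p.1 - τ • p.2) - p.1))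
  refine ⟨fun k => (step^[k] (x₀, y₀)).1, fun k => (step^[k] (x₀, y₀)).2, rfl, rfl, ?_⟩
  rw [isRun_bilin_iff' hτ hσ]
  intro k
  simp only [Function.iterate_succ_apply']
  simp [step]

theorem spectrum_iterMatrix {τ σ : ℝ} (h : τ * σ = 4 / 3) :
    spectrum ℝ (iterMatrix τ σ) = {-1, 1 / 3} := by
  ext μ
  rw [spectrum.mem_iff, Matrix.isUnit_iff_isUnit_det, isUnit_iff_ne_zero, not_not,
    Matrix.det_fin_two]
  simp only [iterMatrix, Matrix.sub_apply, Matrix.algebraMap_matrix_apply, Matrix.of_apply,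
    Matrix.cons_val_zero, Matrix.cons_val_one, Set.mem_insert_iff, Set.mem_singleton_iff]
  rw [← sub_eq_zero (a := μ), ← sub_eq_zero (a := μ) (b := 1 / 3), ← mul_eq_zero]
  have e : (μ - -1) * (μ - 1 / 3) = (μ - 1) * (μ - (1 - 2 * τ * σ)) - -(-τ) * -σ := by
    linear_combination (1 - 2 * μ) * h
  rw [e]
  simp

/-- `(σ, -2)` is a left eigenvector of the iteration matrix for `-1`, so `σ x - 2 y` changes sign at
every step and can converge only if it is zero. Its kernel is spanned by `(2, σ)`, the eigenvector
for `1/3`, along which the iterates decay geometrically. -/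
theorem converges_bilin_iff {τ σ : ℝ} (hτ : 0 < τ) (hσ : 0 < σ) (h : τ * σ = 4 / 3)
    {x y : ℕ → Vec 1} (hrun : IsRun bilinF bilinG 1 (τ⁻¹ • 1) (σ⁻¹ • 1) x y) :
    Converges x y ↔ ∃ a : ℝ, x 0 0 = a * 2 ∧ y 0 0 = a * σ := by
  rw [isRun_bilin_iff' hτ hσ] at hrun
  constructor
  · rintro ⟨⟨p, q⟩, hpq⟩
    have hx : Tendsto (fun k => x k 0) atTop (𝓝 (p 0)) :=
      ((by fun_prop : Continuous fun r : Vec 1 × Vec 1 => r.1 0).tendsto (p, q)).comp hpq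
    have hy : Tendsto (fun k => y k 0) atTop (𝓝 (q 0)) :=
      ((by fun_prop : Continuous fun r : Vec 1 × Vec 1 => r.2 0).tendsto (p, q)).comp hpq
    have hw := (hx.const_mul σ).sub (hy.const_mul 2)
    set w : ℕ → ℝ := fun k => σ * x k 0 - 2 * y k 0 with hwdef
    have hflip : ∀ k, w (k + 1) = -w k := fun k => by
      obtain ⟨h1, h2⟩ := hrun k
      simp only [hwdef]
      rw [h2, h1]
      linear_combination 3 * y k 0 * h
    have hlim0 : σ * p 0 - 2 * q 0 = 0 := by
      have h1 := (tendsto_add_atTop_iff_nat 1).mpr hw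
      have := tendsto_nhds_unique (h1.congr hflip) hw.neg
      linarith
    rw [hlim0] at hw
    have habs : ∀ k, |w k| = |w 0| := fun k => by
      induction k with
      | zero => rfl
      | succ k ih => rw [hflip, abs_neg, ih]
    have hw0 : |w 0| = 0 := by
      have := hw.abs.congr habs
      rw [abs_zero] at this
      exact tendsto_nhds_unique tendsto_const_nhds this
    have : σ * x 0 0 - 2 * y 0 0 = 0 := abs_eq_zero.mp hw0
    exact ⟨x 0 0 / 2, by ring, by linarith⟩
  · rintro ⟨a, ha, hb⟩
    have hk : ∀ k, x k 0 = a * 2 * (1 / 3) ^ k ∧ y k 0 = a * σ * (1 / 3) ^ k := by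
      intro k
      induction k with
      | zero => simp [ha, hb]
      | succ k ih =>
        obtain ⟨h1, h2⟩ := hrun k
        have e1 : x (k + 1) 0 = a * 2 * (1 / 3) ^ (k + 1) := by
          rw [h1, ih.1, ih.2]
          linear_combination -a * (1 / 3) ^ k * h
        refine ⟨e1, ?_⟩
        rw [h2, e1, ih.1, ih.2]
        ring
    have hgeo : Tendsto (fun k : ℕ => (1 / 3 : ℝ) ^ k) atTop (𝓝 0) :=
      tendsto_pow_atTop_nhds_zero_of_lt_one (by norm_num) (by norm_num)
    have hconv : ∀ {u : ℕ → Vec 1} {b : ℝ}, (∀ k, u k 0 = b * (1 / 3) ^ k) →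
        Tendsto u atTop (𝓝 0) := by
      intro u b hu
      have h0 : ∀ k, u k = ((1 / 3 : ℝ) ^ k) • EuclideanSpace.single 0 b := fun k =>
        vec_one_ext (by simp [hu k, mul_comm])
      have := hgeo.smul_const (EuclideanSpace.single (0 : Fin 1) b)
      rw [zero_smul] at this
      exact this.congr fun k => (h0 k).symm
    exact ⟨(0, 0), (hconv fun k => (hk k).1).prodMk_nhds (hconv fun k => (hk k).2)⟩

end PrePDHG

/-! ### Assembly of the convergence result and the counterexample -/

theorem lemma3p3 :
    -- (a): bound `ρ₁ < 4/3`
    (∀ ρ₁ : ℝ, 0 < ρ₁ → ρ₁ < 4 / 3 →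
      ∀ (n m : ℕ) (f : PrePDHG.Vec n → EReal) (g : PrePDHG.Vec m → EReal)
        (K : Matrix (Fin m) (Fin n) ℝ) (S M₁ : Matrix (Fin n) (Fin n) ℝ)
        (M₂ : Matrix (Fin m) (Fin m) ℝ),
        PrePDHG.Admissible f g K S M₁ M₂ ρ₁ →
        ∀ (x : ℕ → PrePDHG.Vec n) (y : ℕ → PrePDHG.Vec m),
          PrePDHG.IsRun f g K M₁ M₂ x y →
          ∃ (xs : PrePDHG.Vec n) (ys : PrePDHG.Vec m),
            PrePDHG.IsSaddle f g K xs ys ∧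
              Tendsto (fun k => (x k, y k)) atTop (𝓝 (xs, ys))) ∧
    -- (b): bound `ρ₁ ≥ 4/3`
    (∀ ρ₁ : ℝ, 4 / 3 ≤ ρ₁ →
      ∃ (n m : ℕ) (f : PrePDHG.Vec n → EReal) (g : PrePDHG.Vec m → EReal)
        (K : Matrix (Fin m) (Fin n) ℝ) (S M₁ : Matrix (Fin n) (Fin n) ℝ)
        (M₂ : Matrix (Fin m) (Fin m) ℝ),
        PrePDHG.Admissible f g K S M₁ M₂ ρ₁ ∧
        ∃ (x : ℕ → PrePDHG.Vec n) (y : ℕ → PrePDHG.Vec m),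
          PrePDHG.IsRun f g K M₁ M₂ x y ∧ ¬ PrePDHG.Converges x y) ∧
    -- the instance `min_x max_y x y` with `M₁ = 1/τ`, `M₂ = 1/σ`, `τ σ = 4/3`
    (∀ τ σ : ℝ, 0 < τ → 0 < σ → τ * σ = 4 / 3 →
      (∀ ρ₁ : ℝ, 4 / 3 ≤ ρ₁ →
        PrePDHG.Admissible PrePDHG.bilinF PrePDHG.bilinG 1 0 (τ⁻¹ • 1) (σ⁻¹ • 1) ρ₁) ∧
      (∀ p q : PrePDHG.Vec 1,
        PrePDHG.lagrangian PrePDHG.bilinF PrePDHG.bilinG 1 p q = ((p 0 * q 0 : ℝ) : EReal)) ∧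
      (∀ p q : PrePDHG.Vec 1,
        PrePDHG.IsSaddle PrePDHG.bilinF PrePDHG.bilinG 1 p q ↔ p = 0 ∧ q = 0) ∧
      (∀ x y : ℕ → PrePDHG.Vec 1,
        PrePDHG.IsRun PrePDHG.bilinF PrePDHG.bilinG 1 (τ⁻¹ • 1) (σ⁻¹ • 1) x y ↔
          ∀ k, ![x (k + 1) 0, y (k + 1) 0] = PrePDHG.iterMatrix τ σ *ᵥ ![x k 0, y k 0]) ∧
      spectrum ℝ (PrePDHG.iterMatrix τ σ) = {-1, 1 / 3} ∧
      (∀ x₀ y₀ : PrePDHG.Vec 1, ∃ x y : ℕ → PrePDHG.Vec 1, x 0 = x₀ ∧ y 0 = y₀ ∧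
        PrePDHG.IsRun PrePDHG.bilinF PrePDHG.bilinG 1 (τ⁻¹ • 1) (σ⁻¹ • 1) x y) ∧
      (∀ x y : ℕ → PrePDHG.Vec 1,
        PrePDHG.IsRun PrePDHG.bilinF PrePDHG.bilinG 1 (τ⁻¹ • 1) (σ⁻¹ • 1) x y →
          (PrePDHG.Converges x y ↔ ∃ a : ℝ, x 0 0 = a * 2 ∧ y 0 0 = a * σ))) := by
  refine ⟨fun ρ₁ _ hρ n m f g K S M₁ M₂ h x y hrun => ?_, fun ρ₁ hρ => ?_,
    fun τ σ hτ hσ h => ⟨fun ρ₁ hρ => PrePDHG.admissible_bilin hτ hσ h hρ,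
      PrePDHG.lagrangian_bilin, PrePDHG.isSaddle_bilin_iff, PrePDHG.isRun_bilin_iff hτ hσ,
      PrePDHG.spectrum_iterMatrix h, PrePDHG.exists_isRun_bilin hτ hσ,
      fun x y => PrePDHG.converges_bilin_iff hτ hσ h⟩⟩
  -- The maximum covers `ρ₁ < 1`, where `ρ₁ - 1` is negative.
  · exact hrun.converges_to_saddle h (ε := max (ρ₁ - 1) 0)
      (by linarith [le_max_left (ρ₁ - 1) 0]) (le_max_right _ _)
      (max_lt (by linarith) (by norm_num))
  · have h : (1 : ℝ) * (4 / 3) = 4 / 3 := one_mul _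
    -- One instance serves all `ρ₁`: `τ = 1`, `σ = 4/3`, started at `(1, 0)`, which is off the line
    -- spanned by `(2, σ)`.
    obtain ⟨x, y, hx, hy, hrun⟩ := PrePDHG.exists_isRun_bilin (τ := 1) (σ := 4 / 3) one_pos
      (by norm_num) (EuclideanSpace.single 0 1) 0
    refine ⟨1, 1, PrePDHG.bilinF, PrePDHG.bilinG, 1, 0, _, _,
      PrePDHG.admissible_bilin one_pos (by norm_num) h hρ, x, y, hrun, fun hconv => ?_⟩
    obtain ⟨a, ha, hb⟩ := (PrePDHG.converges_bilin_iff one_pos (by norm_num) h hrun).mp hconv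
    simp only [hx, hy, PiLp.single_apply, if_true, PiLp.zero_apply] at ha hb
    linarith
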